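/- Let $R$ be a semiperfect ring (associative, with $1$; i.e. $R/J(R)$ is semisimple and idempotents lift modulo the Jacobson radical $J(R)$). Fix a complete set of pairwise orthogonal local idempotents $e_1,\dots,e_m$ of $R$ with sum $1$ (an idempotent $e$ is local if $\operatorname{End}_R(eR)$ is a local ring), ordered so that for some $n\le m$ every $e_iR$ is isomorphic to $e_kR$ for exactly one $k\le n$. For $k\le n$ let $\mu_k$ be the number of indices $j\le m$ with $e_jR\cong e_kR$. For a module $M$ let $\operatorname{soc}(M)$ be the sum of its simple submodules and $\operatorname{top}(M)=M/\operatorname{rad}(M)$, where $\operatorname{rad}(M)$ is the intersection of the maximal submodules; put $V_k=\operatorname{top}(e_kR)$ and $V'_k=\operatorname{top}(Re_k)$. The generalised dimension $d$ of a right (left) $R$-module of finite length is the sum over the factors of a composition series, a factor isomorphic to $V_k$ (to $V'_k$) being counted with $\mu_k$. For $X\subseteq R$ let $l(X)=\{r\in R\mid rX=0\}$. Suppose that $R$ has a Nakayama permutation $\pi$, i.e. a permutation $\pi$ of $\{1,\dots,n\}$ such that for every $k\le n$ \[ \operatorname{soc}(e_kR)\cong \operatorname{top}(e_{\pi(k)}R)\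 \text{ as right modules},\qquad \operatorname{soc}(Re_{\pi(k)})\cong \operatorname{top}(Re_k)\ \text{ as left modules}, \] and that $\operatorname{soc}(R_R)=\operatorname{soc}({}_RR)$. Let $T_k=\operatorname{soc}(e_kR)$. Then for every $k\le n$ the right module $T_k$ and the left module $R/l(T_k)$ have finite length and \[ d(T_k)>d(R/l(T_k))\iff \mu_k<\mu_{\pi(k)},\qquad d(T_k)<d(R/l(T_k))\iff \mu_k>\mu_{\pi(k)}. \] If moreover $R$ is finite, then \[ |l(T_k)|\cdot|T_k|>|R|\iff \mu_k<\mu_{\pi(k)},\qquad |l(T_k)|\cdot|T_k|<|R|\iff \mu_k>\mu_{\pi(k)}. \] -/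

import Mathlib

noncomputable section

/-- The right ideal `eR`, as a submodule of the right module `R`. Right `R`-modules are
modules over `Rᵐᵒᵖ`. -/
def rightPrincipal {R : Type*} [Ring R] (e : R) : Submodule Rᵐᵒᵖ R :=
  Submodule.span Rᵐᵒᵖ {e}

/-- The left ideal `Re`. -/
def leftPrincipal {R : Type*} [Ring R] (e : R) : Submodule R R :=
  Submodule.span R {e}

/-- The left annihilator `l(X) = {r | rX = 0}` of a subset `X` of `R`, a left ideal. -/
def leftAnn {R : Type*} [Ring R] (X : Set R) : Submodule R R where
  carrier := {r | ∀ x ∈ X, r * x = 0}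
  add_mem' := by
    intro a b ha hb x hx
    rw [add_mul, ha x hx, hb x hx, add_zero]
  zero_mem' := fun x _ => zero_mul x
  smul_mem' := by
    intro c a ha x hx
    rw [smul_eq_mul, mul_assoc, ha x hx, mul_zero]

/-- The socle of a module: the sum of its simple submodules. -/
def socle (A M : Type*) [Ring A] [AddCommGroup M] [Module A M] : Submodule A M :=
  sSup {N : Submodule A M | IsSimpleModule A N}

/-- The top `M / rad M` of a module, where `rad M` is the intersection of the maximal
submodules of `M`. -/
abbrev ModuleTop (A M : Type*) [Ring A] [AddCommGroup M] [Module A M] : Type _ :=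
  M ⧸ Module.jacobson A M

/-- A ring is semiperfect if it is semilocal and idempotents lift modulo the Jacobson radical. -/
def IsSemiperfectRing (R : Type*) [Ring R] : Prop :=
  IsSemisimpleRing (R ⧸ Ring.jacobson R) ∧
    ∀ x : R, x * x - x ∈ Ring.jacobson R →
      ∃ e : R, IsIdempotentElem e ∧ e - x ∈ Ring.jacobson R

/-- An idempotent `e` is local if the ring `End_R(eR)` is local. -/
def IsLocalIdempotent {R : Type*} [Ring R] (e : R) : Prop :=
  IsIdempotentElem e ∧ IsLocalRing (Module.End Rᵐᵒᵖ (rightPrincipal e))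

/-- A complete set of pairwise orthogonal local idempotents `e_1, …, e_m` with sum `1`, ordered
so that the first `n` of them are a basic set: each `e_i R` is isomorphic to `e_k R` for exactly
one `k ≤ n`. -/
structure BasicDecomposition (R : Type*) [Ring R] where
  m : ℕ
  n : ℕ
  n_le_m : n ≤ m
  idem : Fin m → R
  complete : CompleteOrthogonalIdempotents idem
  isLocal : ∀ i, IsLocalIdempotent (idem i)
  basic : ∀ i : Fin m, ∃! k : Fin n,
    Nonempty (rightPrincipal (idem i) ≃ₗ[Rᵐᵒᵖ] rightPrincipal (idem (Fin.castLE n_le_m k)))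

namespace BasicDecomposition

variable {R : Type*} [Ring R] (D : BasicDecomposition R)

/-- The basic idempotent `e_k`, `k ≤ n`. -/
def e (k : Fin D.n) : R := D.idem (Fin.castLE D.n_le_m k)

/-- The multiplicity `μ_k`: the number of indices `j ≤ m` with `e_j R ≅ e_k R`. -/
def mult (k : Fin D.n) : ℕ :=
  Nat.card {j : Fin D.m //
    Nonempty (rightPrincipal (D.idem j) ≃ₗ[Rᵐᵒᵖ] rightPrincipal (D.e k))}

/-- The simple right module `V_k = top(e_k R)`. -/
abbrev V (k : Fin D.n) : Type _ := ModuleTop Rᵐᵒᵖ (rightPrincipal (D.e k))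

/-- The simple left module `V'_k = top(R e_k)`. -/
abbrev V' (k : Fin D.n) : Type _ := ModuleTop R (leftPrincipal (D.e k))

/-- `π` is a Nakayama permutation: `soc(e_k R) ≅ top(e_{π(k)} R)` as right modules and
`soc(R e_{π(k)}) ≅ top(R e_k)` as left modules, for all `k ≤ n`. -/
def IsNakayamaPerm (π : Equiv.Perm (Fin D.n)) : Prop :=
  ∀ k : Fin D.n,
    Nonempty (socle Rᵐᵒᵖ (rightPrincipal (D.e k)) ≃ₗ[Rᵐᵒᵖ]
      ModuleTop Rᵐᵒᵖ (rightPrincipal (D.e (π k)))) ∧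
    Nonempty (socle R (leftPrincipal (D.e (π k))) ≃ₗ[R]
      ModuleTop R (leftPrincipal (D.e k)))

/-- `T_k = soc(e_k R)`, as a right ideal of `R`. -/
def T (k : Fin D.n) : Submodule Rᵐᵒᵖ R :=
  (socle Rᵐᵒᵖ (rightPrincipal (D.e k))).map (rightPrincipal (D.e k)).subtype

end BasicDecomposition

open Classical in
/-- The value on a simple module `S` of the assignment `V k ↦ μ k` (the `V k` being pairwise
non-isomorphic, so that at most one term of the sum is nonzero). -/
def simpleWeight (A : Type*) [Ring A] {n : ℕ} (V : Fin n → Type*)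
    [∀ k, AddCommGroup (V k)] [∀ k, Module A (V k)] (μ : Fin n → ℕ)
    (S : Type*) [AddCommGroup S] [Module A S] : ℕ :=
  ∑ k, if Nonempty (S ≃ₗ[A] V k) then μ k else 0

/-- The sum of the weights of the factors `I_{i+1} / I_i` of a composition series. -/
def seriesWeight {A : Type*} [Ring A] {n : ℕ} (V : Fin n → Type*)
    [∀ k, AddCommGroup (V k)] [∀ k, Module A (V k)] (μ : Fin n → ℕ)
    {M : Type*} [AddCommGroup M] [Module A M] (s : CompositionSeries (Submodule A M)) : ℕ :=
  ∑ i : Fin s.length,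
    simpleWeight A V μ ((s i.succ : Submodule A M) ⧸ (s i.castSucc).submoduleOf (s i.succ))

/-- The length function induced by `V k ↦ μ k`: the weight of a composition series
`0 = I_0 ⊂ ⋯ ⊂ I_λ = M`. All of them have the same weight by Jordan–Hölder, so the infimum is
that common value; it is `⊤` exactly when there is no composition series. -/
def lengthFunction (A : Type*) [Ring A] {n : ℕ} (V : Fin n → Type*)
    [∀ k, AddCommGroup (V k)] [∀ k, Module A (V k)] (μ : Fin n → ℕ)
    (M : Type*) [AddCommGroup M] [Module A M] : ℕ∞ :=
  ⨅ (s : CompositionSeries (Submodule A M)) (_ : s.head = ⊥ ∧ s.last = ⊤),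
    (seriesWeight V μ s : ℕ∞)

/-- The generalised dimension of a right module: the length function with `V_k ↦ μ_k`. -/
def BasicDecomposition.rightDim {R : Type*} [Ring R] (D : BasicDecomposition R)
    (M : Type*) [AddCommGroup M] [Module Rᵐᵒᵖ M] : ℕ∞ :=
  lengthFunction Rᵐᵒᵖ D.V D.mult M

/-- The generalised dimension of a left module: the length function with `V'_k ↦ μ_k`. -/
def BasicDecomposition.leftDim {R : Type*} [Ring R] (D : BasicDecomposition R)
    (M : Type*) [AddCommGroup M] [Module R M] : ℕ∞ :=
  lengthFunction R D.V' D.mult M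

end

/-! The module `T_k ≅ V_{π(k)}` is simple, so `d(T_k) = μ_{π(k)}`. Pick `x ≠ 0` in `T_k` with `x
e_{π(k)} = x`. Since `T_k = xR`, `l(T_k)` is the annihilator of `x`, so `R/l(T_k) ≅ Rx`. As the two
socles of `R` agree, `x` lies in `T'_{π(k)} = soc(Re_{π(k)})`, which is isomorphic to `V'_k` and
hence simple; thus `Rx = T'_{π(k)}` and `d(R/l(T_k)) = μ_k` (`nonempty_quotient_leftAnn_equiv`).

For finite `R` this gives `|R| = |l(T_k)| |T'_{π(k)}|`, and `|T_k|` is to be compared with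
`|T'_{π(k)}|`. With `S` the common socle, `T_k e_{π(k)}` and `e_k T'_{π(k)}` are the same set `e_k S
e_{π(k)}`, of order `q > 1`. Peirce decomposition of a simple module has as many nonzero parts, all
equipotent, as its multiplicity (`card_eq_pow`), so `|T_k| = q^{μ_{π(k)}}` and `|T'_{π(k)}| =
q^{μ_k}`.

The module theory is done over an arbitrary ring `A` and used for `A = R` and `A = Rᵐᵒᵖ`; locality
and equivalence of idempotents are put in terms of elements, where they are left-right symmetric. -/

/-! ### Local idempotents and the modules they generate -/

/-- An idempotent `e` whose corner ring `eAe` is local, in terms of elements. -/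
structure IsCornerLocal {A : Type*} [Ring A] (e : A) : Prop where
  idem : e * e = e
  ne_zero : e ≠ 0
  unit_or : ∀ a b : A, e * a * e = a → e * b * e = b → a + b = e →
    (∃ c, c * a = e ∧ a * c = e) ∨ (∃ c, c * b = e ∧ b * c = e)

/-- Equivalence of idempotents: `e = uv` and `f = vu` with `u ∈ eAf`, `v ∈ fAe`. -/
def IdemEquiv {A : Type*} [Ring A] (e f : A) : Prop :=
  ∃ u v : A, e * u * f = u ∧ f * v * e = v ∧ u * v = e ∧ v * u = f

/-- The element `p` generates `P`, and `a ↦ a • p` induces an isomorphism from `Ae` to `P`. -/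
structure IsIdemGenerator {A P : Type*} [Ring A] [AddCommGroup P] [Module A P]
    (e : A) (p : P) : Prop where
  exists_smul : ∀ x : P, ∃ a : A, a • p = x
  mul_eq_zero : ∀ a : A, a • p = 0 → a * e = 0
  smul_self : e • p = p

section Abstract

variable {A : Type*} [Ring A] {e f : A}

theorem IdemEquiv.symm (h : IdemEquiv e f) : IdemEquiv f e := by
  obtain ⟨u, v, h1, h2, h3, h4⟩ := h
  exact ⟨v, u, h2, h1, h4, h3⟩

theorem IdemEquiv.op (h : IdemEquiv e f) : IdemEquiv (MulOpposite.op e) (MulOpposite.op f) := by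
  obtain ⟨u, v, h1, h2, h3, h4⟩ := h
  refine ⟨MulOpposite.op v, MulOpposite.op u, ?_, ?_, ?_, ?_⟩
  · rw [← MulOpposite.op_mul, ← MulOpposite.op_mul, ← mul_assoc, h2]
  · rw [← MulOpposite.op_mul, ← MulOpposite.op_mul, ← mul_assoc, h1]
  · rw [← MulOpposite.op_mul, h3]
  · rw [← MulOpposite.op_mul, h4]

theorem idemEquiv_op_iff :
    IdemEquiv (MulOpposite.op e) (MulOpposite.op f) ↔ IdemEquiv e f := by
  refine ⟨fun ⟨u, v, h1, h2, h3, h4⟩ => ?_, IdemEquiv.op⟩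
  refine ⟨v.unop, u.unop, ?_, ?_, ?_, ?_⟩
  · simpa [mul_assoc] using congrArg MulOpposite.unop h2
  · simpa [mul_assoc] using congrArg MulOpposite.unop h1
  · simpa using congrArg MulOpposite.unop h3
  · simpa using congrArg MulOpposite.unop h4

/-- Locality is assumed for `End(eR)` only; this symmetry makes it available on both sides. -/
theorem IsCornerLocal.op (h : IsCornerLocal e) : IsCornerLocal (MulOpposite.op e) where
  idem := by rw [← MulOpposite.op_mul, h.idem]
  ne_zero := by simpa using h.ne_zero
  unit_or a b ha hb hab := by
    have ha' : e * a.unop * e = a.unop := by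
      simpa [mul_assoc] using congrArg MulOpposite.unop ha
    have hb' : e * b.unop * e = b.unop := by
      simpa [mul_assoc] using congrArg MulOpposite.unop hb
    have hab' : a.unop + b.unop = e := by simpa using congrArg MulOpposite.unop hab
    rcases h.unit_or _ _ ha' hb' hab' with ⟨c, h1, h2⟩ | ⟨c, h1, h2⟩
    · exact Or.inl ⟨MulOpposite.op c, MulOpposite.unop_injective (by simpa using h2),
        MulOpposite.unop_injective (by simpa using h1)⟩
    · exact Or.inr ⟨MulOpposite.op c, MulOpposite.unop_injective (by simpa using h2),
        MulOpposite.unop_injective (by simpa using h1)⟩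

/-- A local idempotent `e` which factors as `uv` through a local idempotent `f` is equivalent
to `f`. -/
theorem IsCornerLocal.idemEquiv_of_mul_eq (he : IsCornerLocal e) (hf : IsCornerLocal f) {u v : A}
    (hu : e * u * f = u) (hv : f * v * e = v) (huv : u * v = e) : IdemEquiv e f := by
  have huf : u * f = u := by rw [← hu, mul_assoc, hf.idem]
  have hfv : f * v = v := by rw [← hv, ← mul_assoc, ← mul_assoc, hf.idem]
  have hve : v * e = v := by rw [← hv, mul_assoc, he.idem]
  have hg : (v * u) * (v * u) = v * u := by
    rw [mul_assoc, ← mul_assoc u, huv, ← mul_assoc, hve]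
  have hfg : f * (v * u) = v * u := by rw [← mul_assoc, hfv]
  have hgf : (v * u) * f = v * u := by rw [mul_assoc, huf]
  have hne : v * u ≠ 0 := by
    intro h0
    apply he.ne_zero
    calc e = e * e := he.idem.symm
      _ = u * (v * u) * v := by rw [← mul_assoc, huv, mul_assoc, huv]
      _ = 0 := by rw [h0, mul_zero, zero_mul]
  refine ⟨u, v, hu, hv, huv, ?_⟩
  -- The complementary idempotents `v * u` and `f - v * u` of `fAf` cannot both be non-units; an
  -- invertible idempotent is the identity `f`, and `v * u ≠ 0` excludes the second case.
  rcases hf.unit_or (v * u) (f - v * u) (by rw [hfg, hgf])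
      (by rw [mul_sub, hf.idem, hfg, sub_mul, hf.idem, hgf]) (by abel) with
    ⟨c, h1, -⟩ | ⟨c, h1, -⟩
  · rw [← hfg, ← h1, mul_assoc, hg]
  · exfalso
    apply hne
    rw [← hfg, ← h1, mul_assoc, sub_mul, hfg, hg, sub_self, mul_zero]

variable {P : Type*} [AddCommGroup P] [Module A P] {p : P}

theorem IsIdemGenerator.span_eq_top (hp : IsIdemGenerator e p) :
    Submodule.span A {p} = ⊤ :=
  eq_top_iff.2 fun x _ => Submodule.mem_span_singleton.2 (hp.exists_smul x)

theorem IsIdemGenerator.ne_zero (hp : IsIdemGenerator e p) (he : IsCornerLocal e) : p ≠ 0 := by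
  rintro rfl
  apply he.ne_zero
  simpa using hp.mul_eq_zero 1 (by simp)

theorem IsIdemGenerator.eq_top_of_mem (hp : IsIdemGenerator e p) {N : Submodule A P}
    (h : p ∈ N) : N = ⊤ :=
  eq_top_iff.2 (hp.span_eq_top ▸ (Submodule.span_singleton_le_iff_mem p N).2 h)

/-- The module generated by a local idempotent is not a sum of two proper submodules. -/
theorem IsIdemGenerator.eq_top_or (hp : IsIdemGenerator e p) (he : IsCornerLocal e)
    {N N' : Submodule A P} (h : N ⊔ N' = ⊤) : N = ⊤ ∨ N' = ⊤ := by
  have hmem : p ∈ N ⊔ N' := h ▸ Submodule.mem_top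
  obtain ⟨x, hx, y, hy, hxy⟩ := Submodule.mem_sup.1 hmem
  obtain ⟨a, rfl⟩ := hp.exists_smul x
  obtain ⟨b, rfl⟩ := hp.exists_smul y
  have key : ∀ a c : A, c * (e * a * e) = e → c • e • a • p = p := by
    intro a c h
    have := congrArg (· • p) h
    simpa only [mul_smul, hp.smul_self] using this
  -- From `p = a • p + b • p`: one of the two corner elements is then invertible, and by `key` its
  -- inverse recovers `p` inside `N` or `N'`.
  have hsum : e * a * e + e * b * e = e := by
    have h0 : (a + b - 1) * e = 0 := hp.mul_eq_zero _ (by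
      rw [sub_smul, add_smul, hxy, one_smul, sub_self])
    have h1 : a * e + b * e = e := by
      rw [sub_mul, add_mul, one_mul] at h0
      exact sub_eq_zero.1 h0
    rw [mul_assoc, mul_assoc, ← mul_add, h1, he.idem]
  have hid : ∀ a : A, e * (e * a * e) * e = e * a * e := fun a => by
    simp only [mul_assoc, he.idem]
    simp only [← mul_assoc, he.idem]
  rcases he.unit_or _ _ (hid a) (hid b) hsum with ⟨c, hc, -⟩ | ⟨c, hc, -⟩
  · exact Or.inl (hp.eq_top_of_mem (key a c hc ▸ N.smul_mem _ (N.smul_mem _ hx)))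
  · exact Or.inr (hp.eq_top_of_mem (key b c hc ▸ N'.smul_mem _ (N'.smul_mem _ hy)))

/-- A nonzero cyclic module has a maximal submodule `K`. A proper submodule not below `K` would span
the module together with `K`, contradicting `eq_top_or`; so `K` is the only maximal submodule. -/
theorem IsIdemGenerator.isCoatom_jacobson_and_le (hp : IsIdemGenerator e p)
    (he : IsCornerLocal e) :
    IsCoatom (Module.jacobson A P) ∧ ∀ N : Submodule A P, N ≠ ⊤ → N ≤ Module.jacobson A P := by
  have : Module.Finite A P := ⟨⟨{p}, by simpa using hp.span_eq_top⟩⟩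
  have hbot : (⊥ : Submodule A P) ≠ ⊤ := fun h =>
    hp.ne_zero he ((Submodule.mem_bot A).1 (h ▸ Submodule.mem_top))
  obtain ⟨K, hK, -⟩ := (eq_top_or_exists_le_coatom (⊥ : Submodule A P)).resolve_left hbot
  have hle : ∀ N : Submodule A P, N ≠ ⊤ → N ≤ K := by
    intro N hN
    by_contra hNK
    have : K ⊔ N = ⊤ := hK.2 _ (lt_of_le_of_ne le_sup_left fun h => hNK (h ▸ le_sup_right))
    rcases hp.eq_top_or he this with h | h
    · exact hK.1 h
    · exact hN h
  have hJ : Module.jacobson A P = K := by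
    apply le_antisymm
    · exact sInf_le hK
    · refine le_sInf fun N hN => ?_
      have hN' : IsCoatom N := hN
      rcases (hle N hN'.1).lt_or_eq with h | h
      · exact absurd (hN'.2 _ h) hK.1
      · exact h.ge
  rw [hJ]
  exact ⟨hK, hle⟩

theorem IsIdemGenerator.isSimpleModule_top (hp : IsIdemGenerator e p) (he : IsCornerLocal e) :
    IsSimpleModule A (ModuleTop A P) :=
  isSimpleModule_iff_isCoatom.2 (hp.isCoatom_jacobson_and_le he).1

theorem IsIdemGenerator.exists_fixed_top (hp : IsIdemGenerator e p) (he : IsCornerLocal e) :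
    ∃ x : ModuleTop A P, e • x = x ∧ x ≠ 0 := by
  refine ⟨(Module.jacobson A P).mkQ p, by rw [← map_smul, hp.smul_self], fun h => ?_⟩
  rw [Submodule.mkQ_apply, Submodule.Quotient.mk_eq_zero] at h
  exact (hp.isCoatom_jacobson_and_le he).1.1 (hp.eq_top_of_mem h)

/-- A lift `f • a • p` of `x` lies outside the largest proper submodule, so it generates `P`. Then
`b • f • a • p = p` for some `b`, which makes `e` factor through `f`. -/
theorem IsIdemGenerator.idemEquiv_of_fixed_top (hp : IsIdemGenerator e p) (he : IsCornerLocal e)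
    (hf : IsCornerLocal f) (x : ModuleTop A P) (hx : f • x = x) (hx0 : x ≠ 0) :
    IdemEquiv e f := by
  obtain ⟨y, rfl⟩ := Submodule.mkQ_surjective _ x
  obtain ⟨a, rfl⟩ := hp.exists_smul y
  have hnot : f • a • p ∉ Module.jacobson A P := by
    intro h
    apply hx0
    rw [← hx, ← map_smul, Submodule.mkQ_apply, Submodule.Quotient.mk_eq_zero]
    exact h
  have htop : Submodule.span A {f • a • p} = ⊤ := by
    by_contra h
    exact hnot ((hp.isCoatom_jacobson_and_le he).2 _ h (Submodule.mem_span_singleton_self _))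
  obtain ⟨b, hb⟩ := Submodule.mem_span_singleton.1
    (htop ▸ Submodule.mem_top : p ∈ Submodule.span A {f • a • p})
  have h1 : b * f * a * e = e := by
    have := hp.mul_eq_zero (b * f * a - 1) (by
      rw [sub_smul, mul_smul, mul_smul, hb, one_smul, sub_self])
    rw [sub_mul, one_mul] at this
    exact sub_eq_zero.1 this
  refine he.idemEquiv_of_mul_eq hf (u := e * b * f) (v := f * a * e) ?_ ?_ ?_
  · rw [mul_assoc, mul_assoc (e * b), hf.idem, ← mul_assoc, ← mul_assoc, he.idem]
  · rw [mul_assoc, mul_assoc (f * a), he.idem, ← mul_assoc, ← mul_assoc, hf.idem]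
  · calc e * b * f * (f * a * e) = e * (b * (f * f) * a * e) := by simp only [mul_assoc]
      _ = e := by rw [hf.idem, h1, he.idem]

variable {M : Type*} [AddCommGroup M] [Module A M]

/-- Equivalent idempotents cut out equipotent parts of a module. -/
theorem IdemEquiv.card_fixed (h : IdemEquiv e f) :
    Nat.card {x : M // e • x = x} = Nat.card {x : M // f • x = x} := by
  obtain ⟨u, v, hu, hv, huv, hvu⟩ := h
  have key : ∀ {e f u v : A}, e * u * f = u → f * v * e = v → u * v = e → v * u = f →
      ∀ x : M, e • x = x → f • v • x = v • x := by
    intro e f u v hu hv huv hvu x hx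
    rw [← hvu, mul_smul, ← mul_smul u, huv, hx]
  refine Nat.card_congr
    { toFun := fun x => ⟨v • x.1, key hu hv huv hvu x.1 x.2⟩
      invFun := fun x => ⟨u • x.1, key hv hu hvu huv x.1 x.2⟩
      left_inv := fun x => Subtype.ext ?_
      right_inv := fun x => Subtype.ext ?_ }
  · change u • v • x.1 = x.1
    rw [← mul_smul, huv, x.2]
  · change v • u • x.1 = x.1
    rw [← mul_smul, hvu, x.2]

/-- The Peirce decomposition of a module. -/
theorem card_eq_prod_card_fixed {m : ℕ} {g : Fin m → A} (hg : CompleteOrthogonalIdempotents g)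
    (M : Type*) [AddCommGroup M] [Module A M] :
    Nat.card M = ∏ j, Nat.card {x : M // g j • x = x} := by
  rw [← Nat.card_pi]
  refine Nat.card_congr
    { toFun := fun x j => ⟨g j • x, by rw [← mul_smul, (hg.idem j).eq]⟩
      invFun := fun y => ∑ j, (y j).1
      left_inv := fun x => ?_
      right_inv := fun y => ?_ }
  · change ∑ j, g j • x = x
    rw [← Finset.sum_smul, hg.complete, one_smul]
  · funext j
    refine Subtype.ext ?_
    change g j • ∑ i, (y i).1 = (y j).1
    rw [Finset.smul_sum, Finset.sum_eq_single j]
    · exact (y j).2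
    · intro i _ hij
      rw [← (y i).2, ← mul_smul, hg.ortho hij.symm, zero_smul]
    · simp

/-- The order of a module isomorphic to the top of `Ae` is a power of the order of its part cut
out by `e`, the exponent being the multiplicity of `e`. -/
theorem IsIdemGenerator.card_eq_pow (hp : IsIdemGenerator e p) (he : IsCornerLocal e)
    {m : ℕ} {g : Fin m → A} (hg : CompleteOrthogonalIdempotents g)
    (hgl : ∀ j, IsCornerLocal (g j)) (φ : M ≃ₗ[A] ModuleTop A P) :
    Nat.card M = Nat.card {x : M // e • x = x} ^ Nat.card {j // IdemEquiv (g j) e} := by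
  classical
  rw [card_eq_prod_card_fixed hg M]
  have hj : ∀ j, Nat.card {x : M // g j • x = x} =
      if IdemEquiv (g j) e then Nat.card {x : M // e • x = x} else 1 := by
    intro j
    split_ifs with h
    · exact h.card_fixed
    · have : Unique {x : M // g j • x = x} :=
        { default := ⟨0, smul_zero _⟩
          uniq := fun x => by
            refine Subtype.ext ?_
            by_contra hx
            refine h (hp.idemEquiv_of_fixed_top he (hgl j) (φ x.1) ?_ ?_).symm
            · rw [← map_smul, x.2]
            · simpa using hx }
      exact Nat.card_unique
  rw [Finset.prod_congr rfl fun j _ => hj j, Finset.prod_ite, Finset.prod_const,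
    Finset.prod_const_one, mul_one,
    Nat.card_eq_fintype_card (α := {j // IdemEquiv (g j) e}), Fintype.card_subtype]

theorem IsIdemGenerator.exists_fixed (hp : IsIdemGenerator e p) (he : IsCornerLocal e)
    (φ : M ≃ₗ[A] ModuleTop A P) : ∃ x : M, e • x = x ∧ x ≠ 0 := by
  obtain ⟨x, hx, hx0⟩ := hp.exists_fixed_top he
  exact ⟨φ.symm x, by rw [← map_smul, hx], by simpa using hx0⟩

theorem IsIdemGenerator.idemEquiv_of_top_equiv {Q : Type*} [AddCommGroup Q] [Module A Q] {q : Q}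
    (hp : IsIdemGenerator e p) (he : IsCornerLocal e) (hq : IsIdemGenerator f q)
    (hf : IsCornerLocal f) (φ : ModuleTop A P ≃ₗ[A] ModuleTop A Q) : IdemEquiv e f := by
  obtain ⟨x, hx, hx0⟩ := hq.exists_fixed hf φ
  exact hp.idemEquiv_of_fixed_top he hf x hx hx0

/-! ### Socles and length functions -/

/-- By Schur's lemma the image of a simple submodule is simple or zero. -/
theorem map_mem_socle {N : Type*} [AddCommGroup N] [Module A N] (φ : M →ₗ[A] N) {x : M}
    (hx : x ∈ socle A M) : φ x ∈ socle A N := by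
  have : socle A M ≤ (socle A N).comap φ := by
    refine sSup_le fun S hS => ?_
    have hS' : IsSimpleModule A S := hS
    rw [← Submodule.map_le_iff_le_comap]
    rcases LinearMap.injective_or_eq_zero (φ.comp S.subtype) with h | h
    · have hsimple : IsSimpleModule A (LinearMap.range (φ.comp S.subtype)) :=
        IsSimpleModule.congr (LinearEquiv.ofInjective _ h).symm
      rw [LinearMap.range_comp, Submodule.range_subtype] at hsimple
      exact le_sSup hsimple
    · have : S.map φ = ⊥ := by
        rw [← Submodule.range_subtype S, ← LinearMap.range_comp, h, LinearMap.range_zero]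
      rw [this]
      exact bot_le
  exact this hx

theorem simpleWeight_congr {n : ℕ} (V : Fin n → Type*)
    [∀ k, AddCommGroup (V k)] [∀ k, Module A (V k)] (μ : Fin n → ℕ)
    {S S' : Type*} [AddCommGroup S] [Module A S] [AddCommGroup S'] [Module A S']
    (φ : S ≃ₗ[A] S') : simpleWeight A V μ S = simpleWeight A V μ S' := by
  unfold simpleWeight
  refine Finset.sum_congr rfl fun k _ => ?_
  have : Nonempty (S ≃ₗ[A] V k) ↔ Nonempty (S' ≃ₗ[A] V k) :=
    ⟨fun ⟨ψ⟩ => ⟨φ.symm.trans ψ⟩, fun ⟨ψ⟩ => ⟨φ.trans ψ⟩⟩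
  classical
  exact if_congr this rfl rfl

theorem simpleWeight_eq {n : ℕ} (V : Fin n → Type*)
    [∀ k, AddCommGroup (V k)] [∀ k, Module A (V k)] (μ : Fin n → ℕ)
    (hV : ∀ i j, Nonempty (V i ≃ₗ[A] V j) → i = j)
    {S : Type*} [AddCommGroup S] [Module A S] {k : Fin n} (φ : S ≃ₗ[A] V k) :
    simpleWeight A V μ S = μ k := by
  unfold simpleWeight
  rw [Finset.sum_eq_single k, if_pos ⟨φ⟩]
  · rintro j - hj
    rw [if_neg]
    rintro ⟨ψ⟩
    exact hj (hV _ _ ⟨ψ.symm.trans φ⟩)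
  · simp

/-- The length function of a simple module is its weight. -/
theorem lengthFunction_of_isSimpleModule {n : ℕ} (V : Fin n → Type*)
    [∀ k, AddCommGroup (V k)] [∀ k, Module A (V k)] (μ : Fin n → ℕ)
    (S : Type*) [AddCommGroup S] [Module A S] [IsSimpleModule A S] :
    lengthFunction A V μ S = simpleWeight A V μ S := by
  have hquot : ∀ N N' : Submodule A S, N = ⊥ → N' = ⊤ →
      simpleWeight A V μ (N' ⧸ N.submoduleOf N') = simpleWeight A V μ S := by
    rintro N N' rfl rfl
    refine simpleWeight_congr V μ ?_
    refine (Submodule.quotEquivOfEqBot _ ?_).trans Submodule.topEquiv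
    exact Submodule.comap_bot _ |>.trans (Submodule.ker_subtype _)
  have hweight : ∀ s : CompositionSeries (Submodule A S), s.head = ⊥ → s.last = ⊤ →
      seriesWeight V μ s = simpleWeight A V μ S := by
    rintro ⟨l, f, hf⟩ h0 h1
    change f 0 = ⊥ at h0
    change f (Fin.last l) = ⊤ at h1
    have hmono : StrictMono f := Fin.strictMono_iff_lt_succ.2 fun i => (hf i).lt
    -- A strictly increasing chain from `⊥` to `⊤` in a two-element lattice has exactly one step.
    have hl : l = 1 := by
      rcases l with _ | _ | l
      · exact absurd (h0.symm.trans h1) bot_ne_top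
      · rfl
      · exfalso
        have h2 : f 0 < f 1 := hmono (by simp)
        have h3 : f 1 < f (Fin.last _) := hmono (by simp [Fin.lt_def])
        rcases eq_bot_or_eq_top (f 1) with h | h
        · rw [h0, h] at h2
          exact lt_irrefl _ h2
        · rw [h1, h] at h3
          exact lt_irrefl _ h3
    subst hl
    unfold seriesWeight
    change ∑ i : Fin 1, _ = _
    rw [Fin.sum_univ_one]
    exact hquot _ _ h0 h1
  unfold lengthFunction
  apply le_antisymm
  · let s : CompositionSeries (Submodule A S) :=
      { length := 1
        toFun := ![⊥, ⊤]
        step := fun i => by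
          fin_cases i
          exact bot_covBy_top (α := Submodule A S) }
    have h0 : s.head = ⊥ := rfl
    have h1 : s.last = ⊤ := by rfl
    exact iInf₂_le_of_le s ⟨h0, h1⟩ (by rw [hweight s h0 h1])
  · exact le_iInf₂ fun s hs => by rw [hweight s hs.1 hs.2]

end Abstract

/-! ### Idempotents of a ring and their principal one-sided ideals -/

section Principal

variable {R : Type*} [Ring R] {e f : R}

theorem mem_rightPrincipal (he : IsIdempotentElem e) {x : R} :
    x ∈ rightPrincipal e ↔ e * x = x := by
  unfold rightPrincipal
  rw [Submodule.mem_span_singleton]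
  constructor
  · rintro ⟨a, rfl⟩
    rw [← MulOpposite.op_unop a, op_smul_eq_mul, ← mul_assoc, he.eq]
  · intro h
    exact ⟨MulOpposite.op x, h⟩

theorem mem_leftPrincipal (he : IsIdempotentElem e) {x : R} :
    x ∈ leftPrincipal e ↔ x * e = x := by
  unfold leftPrincipal
  rw [Submodule.mem_span_singleton]
  constructor
  · rintro ⟨a, rfl⟩
    rw [smul_eq_mul, mul_assoc, he.eq]
  · intro h
    exact ⟨x, h⟩

theorem isIdemGenerator_rightPrincipal (he : IsIdempotentElem e) :
    IsIdemGenerator (MulOpposite.op e)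
      (⟨e, Submodule.mem_span_singleton_self e⟩ : rightPrincipal e) where
  exists_smul x := ⟨MulOpposite.op x.1, Subtype.ext ((mem_rightPrincipal he).1 x.2)⟩
  mul_eq_zero _ h := MulOpposite.unop_injective (congrArg Subtype.val h)
  smul_self := Subtype.ext he.eq

theorem isIdemGenerator_leftPrincipal (he : IsIdempotentElem e) :
    IsIdemGenerator e (⟨e, Submodule.mem_span_singleton_self e⟩ : leftPrincipal e) where
  exists_smul x := ⟨x.1, Subtype.ext ((mem_leftPrincipal he).1 x.2)⟩
  mul_eq_zero _ h := congrArg Subtype.val h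
  smul_self := Subtype.ext he.eq

/-- Left multiplication by `v ∈ fRe`, as a map from `eR` to `fR`. -/
def mulLeftPrincipal (hf : IsIdempotentElem f) (e : R) {v : R} (hv : f * v = v) :
    rightPrincipal e →ₗ[Rᵐᵒᵖ] rightPrincipal f where
  toFun x := ⟨v * x.1, (mem_rightPrincipal hf).2 (by rw [← mul_assoc, hv])⟩
  map_add' x y := Subtype.ext (mul_add _ _ _)
  map_smul' a x := Subtype.ext (mul_assoc v x.1 a.unop).symm

theorem map_rightPrincipal_apply (he : IsIdempotentElem e)
    (φ : rightPrincipal e →ₗ[Rᵐᵒᵖ] rightPrincipal f) (x : rightPrincipal e) :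
    (φ x : R) = φ ⟨e, Submodule.mem_span_singleton_self e⟩ * x.1 := by
  have hx : x = MulOpposite.op x.1 • (⟨e, Submodule.mem_span_singleton_self e⟩ :
      rightPrincipal e) := Subtype.ext ((mem_rightPrincipal he).1 x.2).symm
  conv_lhs => rw [hx, map_smul]
  rfl

/-- Homomorphisms `eR → fR` are left multiplications by elements of `fRe`; an isomorphism and its
inverse supply `v` and `u`. -/
theorem nonempty_rightPrincipal_equiv_iff (he : IsIdempotentElem e) (hf : IsIdempotentElem f) :
    Nonempty (rightPrincipal e ≃ₗ[Rᵐᵒᵖ] rightPrincipal f) ↔ IdemEquiv e f := by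
  constructor
  · rintro ⟨φ⟩
    set e' : rightPrincipal e := ⟨e, Submodule.mem_span_singleton_self e⟩ with he'
    set f' : rightPrincipal f := ⟨f, Submodule.mem_span_singleton_self f⟩ with hf'
    have h1 : ∀ x, (φ x : R) = φ e' * x.1 := map_rightPrincipal_apply he φ.toLinearMap
    have h2 : ∀ x, (φ.symm x : R) = φ.symm f' * x.1 :=
      map_rightPrincipal_apply hf φ.symm.toLinearMap
    refine ⟨φ.symm f', φ e', ?_, ?_, ?_, ?_⟩
    · rw [(mem_rightPrincipal he).1 (φ.symm f').2, ← h2 f']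
    · rw [(mem_rightPrincipal hf).1 (φ e').2, ← h1 e']
    · rw [← h2, φ.symm_apply_apply]
    · rw [← h1, φ.apply_symm_apply]
  · rintro ⟨u, v, hu, hv, huv, hvu⟩
    have hu' : e * u = u := by rw [← hu, ← mul_assoc, ← mul_assoc, he.eq]
    have hv' : f * v = v := by rw [← hv, ← mul_assoc, ← mul_assoc, hf.eq]
    refine ⟨LinearEquiv.ofLinearMap (mulLeftPrincipal hf e hv') (mulLeftPrincipal he f hu')
      ?_ ?_⟩
    · ext x
      change v * (u * x.1) = x.1
      rw [← mul_assoc, hvu, (mem_rightPrincipal hf).1 x.2]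
    · ext x
      change u * (v * x.1) = x.1
      rw [← mul_assoc, huv, (mem_rightPrincipal he).1 x.2]

/-- Elements of `eRe` act on `eR` by left multiplication; if such an endomorphism is invertible, its
inverse sends `e` to the inverse in the corner. -/
theorem IsLocalIdempotent.isCornerLocal (h : IsLocalIdempotent e) : IsCornerLocal e := by
  obtain ⟨he, hloc⟩ := h
  set e' : rightPrincipal e := ⟨e, Submodule.mem_span_singleton_self e⟩ with he'
  have hmul : ∀ {a : R}, e * a * e = a → e * a = a := fun {a} ha => by
    rw [← ha, ← mul_assoc, ← mul_assoc, he.eq]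
  have hunit : ∀ {a : R} (ha : e * a * e = a),
      IsUnit (mulLeftPrincipal he e (hmul ha) : Module.End Rᵐᵒᵖ (rightPrincipal e)) →
      ∃ c, c * a = e ∧ a * c = e := by
    intro a ha hu
    obtain ⟨ψ, h1, h2⟩ := isUnit_iff_exists.1 hu
    refine ⟨ψ e', ?_, ?_⟩
    · have h3 := congrArg Subtype.val (LinearMap.congr_fun h2 e')
      rw [Module.End.mul_apply, map_rightPrincipal_apply he ψ] at h3
      have h4 : a * e = a := by rw [← ha, mul_assoc, he.eq]
      change _ * (a * e) = e at h3
      rwa [h4] at h3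
    · exact congrArg Subtype.val (LinearMap.congr_fun h1 e')
  refine ⟨he.eq, ?_, ?_⟩
  · rintro rfl
    refine one_ne_zero (α := Module.End Rᵐᵒᵖ (rightPrincipal (0 : R))) ?_
    ext x
    have := (mem_rightPrincipal he).1 x.2
    rw [zero_mul] at this
    simpa using this.symm
  · intro a b ha hb hab
    have hsum : (mulLeftPrincipal he e (hmul ha) : Module.End Rᵐᵒᵖ (rightPrincipal e)) +
        mulLeftPrincipal he e (hmul hb) = 1 := by
      ext x
      change a * x.1 + b * x.1 = x.1
      rw [← add_mul, hab, (mem_rightPrincipal he).1 x.2]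
    exact (IsLocalRing.isUnit_or_isUnit_of_add_one hsum).imp (hunit ha) (hunit hb)

/-- Both the inclusion of the summand `eR` and the projection `x ↦ e * x` preserve socles. -/
theorem mem_map_socle_rightPrincipal (he : IsIdempotentElem e) {x : R} :
    x ∈ (socle Rᵐᵒᵖ (rightPrincipal e)).map (rightPrincipal e).subtype ↔
      x ∈ socle Rᵐᵒᵖ R ∧ e * x = x := by
  constructor
  · rintro ⟨y, hy, rfl⟩
    exact ⟨map_mem_socle _ hy, (mem_rightPrincipal he).1 y.2⟩
  · rintro ⟨hx, hex⟩
    let φ : R →ₗ[Rᵐᵒᵖ] rightPrincipal e :=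
      { toFun := fun x => ⟨e * x, (mem_rightPrincipal he).2 (by rw [← mul_assoc, he.eq])⟩
        map_add' := fun x y => Subtype.ext (mul_add _ _ _)
        map_smul' := fun a x => Subtype.ext (mul_assoc e x a.unop).symm }
    exact ⟨φ x, map_mem_socle φ hx, hex⟩

theorem mem_map_socle_leftPrincipal (he : IsIdempotentElem e) {x : R} :
    x ∈ (socle R (leftPrincipal e)).map (leftPrincipal e).subtype ↔
      x ∈ socle R R ∧ x * e = x := by
  constructor
  · rintro ⟨y, hy, rfl⟩
    exact ⟨map_mem_socle _ hy, (mem_leftPrincipal he).1 y.2⟩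
  · rintro ⟨hx, hex⟩
    let φ : R →ₗ[R] leftPrincipal e :=
      { toFun := fun x => ⟨x * e, (mem_leftPrincipal he).2 (by rw [mul_assoc, he.eq])⟩
        map_add' := fun x y => Subtype.ext (add_mul _ _ _)
        map_smul' := fun a x => Subtype.ext (mul_assoc a x e) }
    exact ⟨φ x, map_mem_socle φ hx, hex⟩

theorem completeOrthogonalIdempotents_op {m : ℕ} {g : Fin m → R}
    (hg : CompleteOrthogonalIdempotents g) :
    CompleteOrthogonalIdempotents fun j => MulOpposite.op (g j) where
  idem j := by
    change MulOpposite.op (g j) * MulOpposite.op (g j) = _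
    rw [← MulOpposite.op_mul, (hg.idem j).eq]
  ortho i j hij := by
    change MulOpposite.op (g i) * MulOpposite.op (g j) = 0
    rw [← MulOpposite.op_mul, hg.ortho hij.symm, MulOpposite.op_zero]
  complete := by rw [← Finset.op_sum, hg.complete, MulOpposite.op_one]

end Principal

/-! ### Basic decompositions -/

namespace BasicDecomposition

variable {R : Type*} [Ring R] (D : BasicDecomposition R)

theorem isIdempotentElem_e (k : Fin D.n) : IsIdempotentElem (D.e k) := (D.isLocal _).1

theorem isCornerLocal_e (k : Fin D.n) : IsCornerLocal (D.e k) := (D.isLocal _).isCornerLocal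

theorem eq_of_idemEquiv {i j : Fin D.n} (h : IdemEquiv (D.e i) (D.e j)) : i = j :=
  (D.basic (Fin.castLE D.n_le_m i)).unique ⟨LinearEquiv.refl _ _⟩
    ((nonempty_rightPrincipal_equiv_iff (D.isIdempotentElem_e i) (D.isIdempotentElem_e j)).2 h)

/-- This form is symmetric, so the same `μ_k` counts the Peirce parts of left modules. -/
theorem mult_eq (k : Fin D.n) : D.mult k = Nat.card {j // IdemEquiv (D.idem j) (D.e k)} :=
  Nat.card_congr (Equiv.subtypeEquivRight fun j =>
    nonempty_rightPrincipal_equiv_iff (D.isLocal j).1 (D.isIdempotentElem_e k))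

theorem eq_of_V_equiv {i j : Fin D.n} (h : Nonempty (D.V i ≃ₗ[Rᵐᵒᵖ] D.V j)) : i = j :=
  D.eq_of_idemEquiv (idemEquiv_op_iff.1
    ((isIdemGenerator_rightPrincipal (D.isIdempotentElem_e i)).idemEquiv_of_top_equiv
      (D.isCornerLocal_e i).op (isIdemGenerator_rightPrincipal (D.isIdempotentElem_e j))
      (D.isCornerLocal_e j).op h.some))

theorem eq_of_V'_equiv {i j : Fin D.n} (h : Nonempty (D.V' i ≃ₗ[R] D.V' j)) : i = j :=
  D.eq_of_idemEquiv
    ((isIdemGenerator_leftPrincipal (D.isIdempotentElem_e i)).idemEquiv_of_top_equiv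
      (D.isCornerLocal_e i) (isIdemGenerator_leftPrincipal (D.isIdempotentElem_e j))
      (D.isCornerLocal_e j) h.some)

theorem isSimpleModule_V (k : Fin D.n) : IsSimpleModule Rᵐᵒᵖ (D.V k) :=
  (isIdemGenerator_rightPrincipal (D.isIdempotentElem_e k)).isSimpleModule_top
    (D.isCornerLocal_e k).op

theorem isSimpleModule_V' (k : Fin D.n) : IsSimpleModule R (D.V' k) :=
  (isIdemGenerator_leftPrincipal (D.isIdempotentElem_e k)).isSimpleModule_top
    (D.isCornerLocal_e k)

theorem rightDim_eq {M : Type*} [AddCommGroup M] [Module Rᵐᵒᵖ M] {k : Fin D.n}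
    (φ : M ≃ₗ[Rᵐᵒᵖ] D.V k) : D.rightDim M = D.mult k := by
  have := D.isSimpleModule_V k
  have := IsSimpleModule.congr φ
  rw [rightDim, lengthFunction_of_isSimpleModule,
    simpleWeight_eq D.V D.mult (fun _ _ => D.eq_of_V_equiv) φ]

theorem leftDim_eq {M : Type*} [AddCommGroup M] [Module R M] {k : Fin D.n}
    (φ : M ≃ₗ[R] D.V' k) : D.leftDim M = D.mult k := by
  have := D.isSimpleModule_V' k
  have := IsSimpleModule.congr φ
  rw [leftDim, lengthFunction_of_isSimpleModule,
    simpleWeight_eq D.V' D.mult (fun _ _ => D.eq_of_V'_equiv) φ]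

theorem card_eq_pow_of_equiv_V {M : Type*} [AddCommGroup M] [Module Rᵐᵒᵖ M] {k : Fin D.n}
    (φ : M ≃ₗ[Rᵐᵒᵖ] D.V k) :
    Nat.card M = Nat.card {x : M // MulOpposite.op (D.e k) • x = x} ^ D.mult k := by
  rw [(isIdemGenerator_rightPrincipal (D.isIdempotentElem_e k)).card_eq_pow
    (D.isCornerLocal_e k).op (completeOrthogonalIdempotents_op D.complete)
    (fun j => (D.isLocal j).isCornerLocal.op) φ, D.mult_eq]
  simp only [idemEquiv_op_iff]

theorem card_eq_pow_of_equiv_V' {M : Type*} [AddCommGroup M] [Module R M] {k : Fin D.n}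
    (φ : M ≃ₗ[R] D.V' k) :
    Nat.card M = Nat.card {x : M // D.e k • x = x} ^ D.mult k := by
  rw [(isIdemGenerator_leftPrincipal (D.isIdempotentElem_e k)).card_eq_pow
    (D.isCornerLocal_e k) D.complete (fun j => (D.isLocal j).isCornerLocal) φ, D.mult_eq]

/-- The left socle of `R e_k`, as a left ideal of `R`. -/
def T' (k : Fin D.n) : Submodule R R :=
  (socle R (leftPrincipal (D.e k))).map (leftPrincipal (D.e k)).subtype

theorem mem_T {k : Fin D.n} {x : R} : x ∈ D.T k ↔ x ∈ socle Rᵐᵒᵖ R ∧ D.e k * x = x :=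
  mem_map_socle_rightPrincipal (D.isIdempotentElem_e k)

theorem mem_T' {k : Fin D.n} {x : R} : x ∈ D.T' k ↔ x ∈ socle R R ∧ x * D.e k = x :=
  mem_map_socle_leftPrincipal (D.isIdempotentElem_e k)

/-! ### Consequences of a Nakayama permutation and of equal socles -/

variable {D} {π : Equiv.Perm (Fin D.n)}

theorem IsNakayamaPerm.nonempty_T_equiv (hπ : D.IsNakayamaPerm π) (k : Fin D.n) :
    Nonempty (D.T k ≃ₗ[Rᵐᵒᵖ] D.V (π k)) :=
  ⟨(Submodule.equivMapOfInjective _ (Submodule.subtype_injective _) _).symm.trans (hπ k).1.some⟩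

theorem IsNakayamaPerm.nonempty_T'_equiv (hπ : D.IsNakayamaPerm π) (k : Fin D.n) :
    Nonempty (D.T' (π k) ≃ₗ[R] D.V' k) :=
  ⟨(Submodule.equivMapOfInjective _ (Submodule.subtype_injective _) _).symm.trans (hπ k).2.some⟩

/-- `R / l(T_k)` is isomorphic to the left socle of `R e_{π(k)}`. -/
theorem IsNakayamaPerm.nonempty_quotient_leftAnn_equiv (hπ : D.IsNakayamaPerm π)
    (hsoc : (socle Rᵐᵒᵖ R : Set R) = (socle R R : Set R)) (k : Fin D.n) :
    Nonempty ((R ⧸ leftAnn (D.T k : Set R)) ≃ₗ[R] D.T' (π k)) := by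
  obtain ⟨φ⟩ := hπ.nonempty_T_equiv k
  obtain ⟨φ'⟩ := hπ.nonempty_T'_equiv k
  have hsimp := D.isSimpleModule_V (π k)
  have hsimp' := D.isSimpleModule_V' k
  have hT : IsSimpleModule Rᵐᵒᵖ (D.T k) := IsSimpleModule.congr φ
  have hT' : IsSimpleModule R (D.T' (π k)) := IsSimpleModule.congr φ'
  obtain ⟨x, hx, hx0⟩ := (isIdemGenerator_rightPrincipal
    (D.isIdempotentElem_e (π k))).exists_fixed (D.isCornerLocal_e (π k)).op φ
  have hxe : x.1 * D.e (π k) = x.1 := congrArg Subtype.val hx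
  have hxT' : x.1 ∈ D.T' (π k) :=
    D.mem_T'.2 ⟨hsoc.subset (D.mem_T.1 x.2).1, hxe⟩
  let x' : D.T' (π k) := ⟨x.1, hxT'⟩
  have hx'0 : x' ≠ 0 := fun h => hx0 (Subtype.ext (congrArg (fun y : D.T' (π k) => y.1) h))
  -- Simplicity of `T_k` gives `T_k = xR`, so whatever kills `x` on the left kills `T_k`.
  have hker : LinearMap.ker (LinearMap.toSpanSingleton R (D.T' (π k)) x') =
      leftAnn (D.T k : Set R) := by
    ext r
    rw [LinearMap.mem_ker, LinearMap.toSpanSingleton_apply]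
    constructor
    · intro hr y hy
      have hr' : r * x.1 = 0 := congrArg Subtype.val hr
      obtain ⟨a, ha⟩ := IsSimpleModule.toSpanSingleton_surjective Rᵐᵒᵖ hx0 ⟨y, hy⟩
      have hy' : x.1 * a.unop = y := congrArg Subtype.val ha
      rw [← hy', ← mul_assoc, hr', zero_mul]
    · intro hr
      exact Subtype.ext (hr x.1 x.2)
  exact ⟨(Submodule.quotEquivOfEq _ _ hker.symm).trans
    (LinearMap.quotKerEquivOfSurjective _ (IsSimpleModule.toSpanSingleton_surjective R hx'0))⟩

/-- Both sides count `e_k S e_l`, where `S` is the common socle. -/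
theorem card_fixed_T_eq (hsoc : (socle Rᵐᵒᵖ R : Set R) = (socle R R : Set R)) (k l : Fin D.n) :
    Nat.card {x : D.T k // MulOpposite.op (D.e l) • x = x} =
      Nat.card {x : D.T' l // D.e k • x = x} :=
  Nat.card_congr
    { toFun := fun x => ⟨⟨x.1.1, D.mem_T'.2 ⟨hsoc.subset (D.mem_T.1 x.1.2).1,
        congrArg Subtype.val x.2⟩⟩, Subtype.ext (D.mem_T.1 x.1.2).2⟩
      invFun := fun x => ⟨⟨x.1.1, D.mem_T.2 ⟨hsoc.superset (D.mem_T'.1 x.1.2).1,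
        congrArg Subtype.val x.2⟩⟩, Subtype.ext (D.mem_T'.1 x.1.2).2⟩
      left_inv := fun _ => rfl
      right_inv := fun _ => rfl }

end BasicDecomposition

theorem mainTheorem7 {R : Type*} [Ring R] (hR : IsSemiperfectRing R)
    (D : BasicDecomposition R) (π : Equiv.Perm (Fin D.n)) (hπ : D.IsNakayamaPerm π)
    (hsoc : (socle Rᵐᵒᵖ R : Set R) = (socle R R : Set R)) (k : Fin D.n) :
    (IsFiniteLength Rᵐᵒᵖ (D.T k) ∧ IsFiniteLength R (R ⧸ leftAnn (D.T k : Set R)) ∧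
      (D.rightDim (D.T k) > D.leftDim (R ⧸ leftAnn (D.T k : Set R)) ↔
        D.mult k < D.mult (π k)) ∧
      (D.rightDim (D.T k) < D.leftDim (R ⧸ leftAnn (D.T k : Set R)) ↔
        D.mult k > D.mult (π k))) ∧
    (Finite R →
      (Nat.card (leftAnn (D.T k : Set R)) * Nat.card (D.T k) > Nat.card R ↔
        D.mult k < D.mult (π k)) ∧
      (Nat.card (leftAnn (D.T k : Set R)) * Nat.card (D.T k) < Nat.card R ↔
        D.mult k > D.mult (π k))) := by
  obtain ⟨φ⟩ := hπ.nonempty_T_equiv k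
  obtain ⟨φ'⟩ := hπ.nonempty_T'_equiv k
  obtain ⟨ψ⟩ := hπ.nonempty_quotient_leftAnn_equiv hsoc k
  have hsimp := D.isSimpleModule_V (π k)
  have hsimp' := D.isSimpleModule_V' k
  have hT : IsSimpleModule Rᵐᵒᵖ (D.T k) := IsSimpleModule.congr φ
  have hQ : IsSimpleModule R (R ⧸ leftAnn (D.T k : Set R)) :=
    IsSimpleModule.congr (ψ.trans φ')
  refine ⟨⟨isFiniteLength_iff_isNoetherian_isArtinian.2 ⟨inferInstance, inferInstance⟩,
    isFiniteLength_iff_isNoetherian_isArtinian.2 ⟨inferInstance, inferInstance⟩, ?_, ?_⟩, ?_⟩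
  · rw [D.rightDim_eq φ, D.leftDim_eq (ψ.trans φ'), gt_iff_lt, Nat.cast_lt]
  · rw [D.rightDim_eq φ, D.leftDim_eq (ψ.trans φ'), gt_iff_lt, Nat.cast_lt]
  · intro hfin
    have hR' : Nat.card R =
        Nat.card (leftAnn (D.T k : Set R)) * Nat.card (D.T' (π k)) := by
      rw [Submodule.card_eq_card_quotient_mul_card (leftAnn (D.T k : Set R)),
        Nat.card_congr ψ.toEquiv, mul_comm]
    have hpos : 0 < Nat.card (leftAnn (D.T k : Set R)) := Nat.card_pos
    -- The common base of the two powers must exceed `1` for their comparison to be that of the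
    -- exponents.
    have hq : 1 < Nat.card {x : D.T' (π k) // D.e k • x = x} := by
      obtain ⟨x, hx, hx0⟩ := (isIdemGenerator_leftPrincipal
        (D.isIdempotentElem_e k)).exists_fixed (D.isCornerLocal_e k) φ'
      rw [Finite.one_lt_card_iff_nontrivial]
      exact ⟨⟨⟨x, hx⟩, ⟨0, smul_zero _⟩, fun h => hx0 (congrArg Subtype.val h)⟩⟩
    rw [hR', D.card_eq_pow_of_equiv_V φ, D.card_eq_pow_of_equiv_V' φ',
      BasicDecomposition.card_fixed_T_eq hsoc, gt_iff_lt, gt_iff_lt,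
      Nat.mul_lt_mul_left hpos, Nat.mul_lt_mul_left hpos, Nat.pow_lt_pow_iff_right hq,
      Nat.pow_lt_pow_iff_right hq]
    exact ⟨Iff.rfl, Iff.rfl⟩
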